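/- Let $(\mathcal M,g)$ be a smooth four-dimensional Lorentzian manifold (possibly with boundary and corners) with Levi-Civita connection $D$ and volume form $\in$, let $H_{-1}\subset\mathcal M$ be the initial hypersurface, let $\underline u$ be a smooth optical function, $g(\mathrm{grad}\,\underline u,\mathrm{grad}\,\underline u)=0$, and put ${}^{(g)}e_3=-2\,\mathrm{grad}\,\underline u$. Let $s$ be a smooth function with ${}^{(g)}e_3(s)=1$ and $s=-1$ on $H_{-1}$, let ${}^{(g)}e_4$ be the smooth null vector field with $g({}^{(g)}e_3,{}^{(g)}e_4)=-2$ that is orthogonal to the surfaces $S_{\underline u,s}$ (the intersections of the level sets of $\underline u$ and $s$), and let $({}^{(g)}e_a)_{a=1,2}$ be any smooth local orthonormal frame of $\{{}^{(g)}e_3,{}^{(g)}e_4\}^\perp$ (the geodesic frame). For a null frame $(e_3,e_4,e_1,e_2)$, i.e. $e_3,e_4$ null with $g(e_3,e_4)=-2$ and $e_1,e_2$ orthonormal and orthogonal to $e_3,e_4$, set $$\underline\chi_{ab}=g(D_ae_3,e_b),\quad \underline\xi_a=\tfrac12 g(D_3e_3,e_a),\quad \underline\omega=\tfrac14 g(D_3e_3,e_4),\quad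 \eta_a=\tfrac12 g(D_3e_4,e_a),\quad \underline\eta_a=\tfrac12 g(D_4e_3,e_a),\quad \zeta_a=\tfrac12 g(D_ae_4,e_3),$$ $\in_{ab}=\tfrac12\in(e_a,e_b,e_3,e_4)$, $\mathrm{tr}\underline\chi=\delta^{ab}\underline\chi_{ab}$, ${}^{(a)}\mathrm{tr}\underline\chi=\in^{ab}\underline\chi_{ab}$, $\underline{\hat\chi}_{ab}=\underline\chi_{ab}-\tfrac12\delta_{ab}\mathrm{tr}\underline\chi-\tfrac12\in_{ab}{}^{(a)}\mathrm{tr}\underline\chi$. For a one-form $f$ and $Y$ orthogonal to $e_3,e_4$ set $(\nabla_3f)(Y)=e_3(f(Y))-f(\widehat{D_3Y})$, where $\widehat X=X+\tfrac12g(X,e_3)e_4+\tfrac12g(X,e_4)e_3$. A superscript $(g)$ refers to the geodesic frame. Let $f$ be a smooth one-form with $f({}^{(g)}e_3)=f({}^{(g)}e_4)=0$ that satisfies ${}^{(g)}\nabla_3f=2\,{}^{(g)}\eta$ and $f|_{H_{-1}}=0$, write $f_a=f({}^{(g)}e_a)$, and define the PT frame by $$e_3={}^{(g)}e_3,\qquad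 e_a={}^{(g)}e_a-\tfrac12f_a\,{}^{(g)}e_3,\qquad e_4={}^{(g)}e_4-f^a\,{}^{(g)}e_a+\tfrac14|f|^2\,{}^{(g)}e_3 .$$ Then the Ricci coefficients of the PT frame satisfy $$\underline\omega=0,\qquad \underline\xi=0,\qquad \underline\eta=-\zeta,\qquad {}^{(a)}\mathrm{tr}\underline\chi=0.$$ Moreover, with $\nabla_3$ the horizontal derivative of the PT frame and $f_a=f(e_a)$, $$\nabla_3f=-\tfrac12\mathrm{tr}\underline\chi\,f+2\zeta-\underline{\hat\chi}\cdot f .$$ -/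

import Mathlib

open scoped Manifold ContDiff

noncomputable section

namespace NullGeometry

section Definitions

variable {E : Type*} [NormedAddCommGroup E] [NormedSpace ℝ E]
  {H : Type*} [TopologicalSpace H] (I : ModelWithCorners ℝ E H)
  (M : Type*) [TopologicalSpace M] [ChartedSpace H M] [IsManifold I ∞ M]

/-- (Not necessarily continuous) vector fields on `M`. -/
abbrev VField : Type _ := (p : M) → TangentSpace I p

/-- Fields of covectors on `M`. -/
abbrev OneForm : Type _ := (p : M) → TangentSpace I p →L[ℝ] ℝ

variable {I M}

/-- The vector field `X` is smooth on the set `U`. -/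
def VField.SmoothOn (X : VField I M) (U : Set M) : Prop :=
  ContMDiffOn I I.tangent ∞ (fun p => (Bundle.TotalSpace.mk' E p (X p) : TangentBundle I M)) U

/-- The one-form `ψ` is smooth on `M`, as a section of the cotangent bundle. -/
def OneForm.Smooth (ψ : OneForm I M) : Prop :=
  ContMDiff I (I.prod 𝓘(ℝ, E →L[ℝ] ℝ)) ∞
    (fun p => Bundle.TotalSpace.mk' (E →L[ℝ] ℝ)
      (E := fun p : M => TangentSpace I p →L[ℝ] ℝ) p (ψ p))

variable (I M)

/-- A smooth Lorentzian metric, of signature `(-,+,…,+)`: every tangent space has a timelike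
vector on whose orthogonal complement the metric is positive definite. -/
structure LorentzMetric where
  /-- The bilinear form on each tangent space. -/
  val : (p : M) → TangentSpace I p →L[ℝ] TangentSpace I p →L[ℝ] ℝ
  smooth : ContMDiff I (I.prod 𝓘(ℝ, E →L[ℝ] E →L[ℝ] ℝ)) ∞
    (fun p => Bundle.TotalSpace.mk' (E →L[ℝ] E →L[ℝ] ℝ)
      (E := fun p : M => TangentSpace I p →L[ℝ] TangentSpace I p →L[ℝ] ℝ) p (val p))
  symm : ∀ (p : M) (v w : TangentSpace I p), val p v w = val p w v
  signature : ∀ p : M, ∃ t : TangentSpace I p, val p t t < 0 ∧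
    ∀ v : TangentSpace I p, val p t v = 0 → v ≠ 0 → 0 < val p v v

variable {I M}

/-- `D` is the Levi-Civita connection of `g`: it is torsion free and compatible with `g`.
Here `D Y p v` is the covariant derivative of the vector field `Y` in the direction `v` at `p`. -/
structure IsLeviCivita (g : LorentzMetric I M)
    (D : CovariantDerivative I E (TangentSpace I : M → Type _)) : Prop where
  torsion_free : ∀ (X Y : VField I M) (p : M),
    MDifferentiableAt I I.tangent
      (fun q => (Bundle.TotalSpace.mk' E q (X q) : TangentBundle I M)) p →
    MDifferentiableAt I I.tangent
      (fun q => (Bundle.TotalSpace.mk' E q (Y q) : TangentBundle I M)) p →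
    D Y p (X p) - D X p (Y p) = VectorField.mlieBracket I X Y p
  metric : ∀ (Y Z : VField I M) (p : M) (v : TangentSpace I p),
    MDifferentiableAt I I.tangent
      (fun q => (Bundle.TotalSpace.mk' E q (Y q) : TangentBundle I M)) p →
    MDifferentiableAt I I.tangent
      (fun q => (Bundle.TotalSpace.mk' E q (Z q) : TangentBundle I M)) p →
    mvfderiv I (fun q => g.val q (Y q) (Z q)) p v
      = g.val p (D Y p v) (Z p) + g.val p (Y p) (D Z p v)

/-- `vol` is a metric volume form of `g` on a four dimensional spacetime: at each point it is one
of the two alternating forms with `vol(v₀,v₁,v₂,v₃)² = -det (g(vᵢ,vⱼ))`. The choice between the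
two is the orientation, and no continuity of this choice is needed here. -/
def IsVolumeForm (g : LorentzMetric I M)
    (vol : (p : M) → (TangentSpace I p) [⋀^Fin 4]→ₗ[ℝ] ℝ) : Prop :=
  ∀ (p : M) (v : Fin 4 → TangentSpace I p),
    (vol p v) ^ 2 = - Matrix.det (Matrix.of fun i j => g.val p (v i) (v j))

/-! ### Horizontal structures -/

/-- The projection `X + ½ g(X,e₃) e₄ + ½ g(X,e₄) e₃` of a vector at `p` onto the horizontal space
`{e₃,e₄}^⊥`. -/
def horizontalProj (g : LorentzMetric I M) (e3 e4 : VField I M) (p : M) (v : TangentSpace I p) :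
    TangentSpace I p :=
  v + ((1 / 2 : ℝ) * g.val p v (e3 p)) • e4 p + ((1 / 2 : ℝ) * g.val p v (e4 p)) • e3 p

/-- `Y` is horizontal on `U`, that is, orthogonal to `e₃` and `e₄`. -/
def IsHorizontalOn (g : LorentzMetric I M) (e3 e4 : VField I M) (Y : VField I M) (U : Set M) :
    Prop :=
  ∀ p ∈ U, g.val p (Y p) (e3 p) = 0 ∧ g.val p (Y p) (e4 p) = 0

/-- The horizontal derivative `(∇₃ψ)(Y) = e₃(ψ(Y)) - ψ(∇₃Y)` of a one-form along `e₃`, evaluated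
on a horizontal vector field `Y`, where `∇₃Y` is the horizontal projection of `D₃Y`. Only the
values of `ψ` on horizontal vectors enter. -/
def nabla3 (g : LorentzMetric I M) (D : CovariantDerivative I E (TangentSpace I : M → Type _))
    (e3 e4 : VField I M) (ψ : OneForm I M) (Y : VField I M) (p : M) : ℝ :=
  mvfderiv I (fun q => ψ q (Y q)) p (e3 p)
    - ψ p (horizontalProj g e3 e4 p (D Y p (e3 p)))

/-- The one-form `η(Y) = ½ g(D₃e₄, Y)` evaluated on a horizontal vector at `p`. -/
def etaForm (g : LorentzMetric I M) (D : CovariantDerivative I E (TangentSpace I : M → Type _))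
    (e3 e4 : VField I M) (p : M) (v : TangentSpace I p) : ℝ :=
  (1 / 2 : ℝ) * g.val p (D e4 p (e3 p)) v

variable (I M)

/-- Four vector fields `e₃, e₄, e₁, e₂`; the horizontal ones are indexed by `Fin 2`. -/
structure Frame where
  e3 : VField I M
  e4 : VField I M
  e : Fin 2 → VField I M

variable {I M}

namespace Frame

variable (g : LorentzMetric I M) (D : CovariantDerivative I E (TangentSpace I : M → Type _))
  (vol : (p : M) → (TangentSpace I p) [⋀^Fin 4]→ₗ[ℝ] ℝ) (F : Frame I M)

/-! ### Ricci coefficients of a null frame -/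

/-- `χ̲_{ab} = g(D_a e₃, e_b)` -/
def chib (a b : Fin 2) (p : M) : ℝ := g.val p (D F.e3 p (F.e a p)) (F.e b p)

/-- `ξ̲_a = ½ g(D₃ e₃, e_a)` -/
def xib (a : Fin 2) (p : M) : ℝ := (1 / 2 : ℝ) * g.val p (D F.e3 p (F.e3 p)) (F.e a p)

/-- `ω̲ = ¼ g(D₃ e₃, e₄)` -/
def omegab (p : M) : ℝ := (1 / 4 : ℝ) * g.val p (D F.e3 p (F.e3 p)) (F.e4 p)

/-- `η̲_a = ½ g(D₄ e₃, e_a)` -/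
def etab (a : Fin 2) (p : M) : ℝ := (1 / 2 : ℝ) * g.val p (D F.e3 p (F.e4 p)) (F.e a p)

/-- `ζ_a = ½ g(D_a e₄, e₃)` -/
def zeta (a : Fin 2) (p : M) : ℝ := (1 / 2 : ℝ) * g.val p (D F.e4 p (F.e a p)) (F.e3 p)

/-- The horizontal volume form `∈_{ab} = ½ ∈(e_a, e_b, e₃, e₄)`. -/
def eps (a b : Fin 2) (p : M) : ℝ :=
  (1 / 2 : ℝ) * vol p ![F.e a p, F.e b p, F.e3 p, F.e4 p]

/-- `tr χ̲ = δ^{ab} χ̲_{ab}` -/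
def trchib (p : M) : ℝ := ∑ a, F.chib g D a a p

/-- The anti-trace `⁽ᵃ⁾tr χ̲ = ∈^{ab} χ̲_{ab}`. -/
def atrchib (p : M) : ℝ := ∑ a, ∑ b, F.eps vol a b p * F.chib g D a b p

/-- The shear, from `χ̲_{ab} = χ̲̂_{ab} + ½ δ_{ab} tr χ̲ + ½ ∈_{ab} ⁽ᵃ⁾tr χ̲`. -/
def chibhat (a b : Fin 2) (p : M) : ℝ :=
  F.chib g D a b p - (1 / 2 : ℝ) * (if a = b then 1 else 0) * F.trchib g D p
    - (1 / 2 : ℝ) * F.eps vol a b p * F.atrchib g D vol p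

end Frame

/-! ### The geodesic foliation and its frames -/

variable (I M)

/-- The geodesic foliation of a spacetime `(M, g)` by the level surfaces of an optical function
`u` and of an affine parameter `s` with `s = -1` on the initial hypersurface `Hm1`, with its
null pair `e₃ = -2 grad u` and `e₄`. -/
structure GeodesicFoliation (g : LorentzMetric I M) (Hm1 : Set M) where
  /-- The optical function. -/
  u : M → ℝ
  /-- The affine parameter of `e₃`. -/
  s : M → ℝ
  e3 : VField I M
  e4 : VField I M
  u_smooth : ContMDiff I 𝓘(ℝ, ℝ) ∞ u
  s_smooth : ContMDiff I 𝓘(ℝ, ℝ) ∞ s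
  e3_smooth : e3.SmoothOn Set.univ
  e4_smooth : e4.SmoothOn Set.univ
  /-- `e₃ = -2 grad u` -/
  e3_eq : ∀ (p : M) (v : TangentSpace I p), g.val p (e3 p) v = -2 * mvfderiv I u p v
  /-- `u` is optical: `g(grad u, grad u) = 0`. -/
  e3_null : ∀ p : M, g.val p (e3 p) (e3 p) = 0
  /-- `e₃(s) = 1` -/
  e3_s : ∀ p : M, mvfderiv I s p (e3 p) = 1
  s_init : ∀ p ∈ Hm1, s p = -1
  e4_null : ∀ p : M, g.val p (e4 p) (e4 p) = 0
  e3_e4 : ∀ p : M, g.val p (e3 p) (e4 p) = -2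
  /-- `e₄` is orthogonal to the surfaces `S_{u,s}`. -/
  e4_orth : ∀ (p : M) (v : TangentSpace I p), mvfderiv I u p v = 0 → mvfderiv I s p v = 0 →
    g.val p (e4 p) v = 0

variable {I M}

namespace GeodesicFoliation

variable {g : LorentzMetric I M} {Hm1 : Set M} (G : GeodesicFoliation I M g Hm1)

/-- `ε₁, ε₂` is a smooth orthonormal frame, on the set `U`, of the horizontal structure
`{e₃,e₄}^⊥` of the geodesic foliation (the tangent spaces of the surfaces `S_{u,s}`). -/
structure IsHorizontalFrameOn (ε : Fin 2 → VField I M) (U : Set M) : Prop where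
  smooth : ∀ a, (ε a).SmoothOn U
  horizontal : ∀ a, IsHorizontalOn g G.e3 G.e4 (ε a) U
  orthonormal : ∀ p ∈ U, ∀ a b, g.val p (ε a p) (ε b p) = if a = b then 1 else 0

/-- `f` is the one-form that defines the PT frame: a smooth horizontal one-form of the geodesic
horizontal structure with `∇₃ f = 2 η`, where `∇₃` and `η` are those of the geodesic pair
`(e₃, e₄)`, and with `f = 0` on `Hm1`. The equation is one between horizontal one-forms, so both
sides are evaluated on all (local, smooth) horizontal vector fields. -/
structure IsPTOneForm (D : CovariantDerivative I E (TangentSpace I : M → Type _))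
    (f : OneForm I M) : Prop where
  smooth : f.Smooth
  apply_e3 : ∀ p : M, f p (G.e3 p) = 0
  apply_e4 : ∀ p : M, f p (G.e4 p) = 0
  transport : ∀ (U : Set M) (Y : VField I M), IsOpen U → Y.SmoothOn U →
    IsHorizontalOn g G.e3 G.e4 Y U →
    ∀ p ∈ U, nabla3 g D G.e3 G.e4 f Y p = 2 * etaForm g D G.e3 G.e4 p (Y p)
  init : ∀ p ∈ Hm1, f p = 0

/-- The PT frame of the geodesic frame `(e₃, e₄, ε₁, ε₂)`: with `f_a = f(ε_a)`, it consists of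
`e₃`, `e₄ - f^a ε_a + ¼ |f|² e₃` and `ε_a - ½ f_a e₃`. -/
def ptFrame (f : OneForm I M) (ε : Fin 2 → VField I M) : Frame I M where
  e3 := G.e3
  e4 := fun p => G.e4 p - ∑ a, f p (ε a p) • ε a p
    + ((1 / 4 : ℝ) * ∑ a, (f p (ε a p)) ^ 2) • G.e3 p
  e := fun a p => ε a p - ((1 / 2 : ℝ) * f p (ε a p)) • G.e3 p

end GeodesicFoliation

end Definitions

end NullGeometry

end

/-! ### Lie brackets as commutators of derivations, in charts -/

section

open Set Filter VectorField
open scoped Topology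

variable {E : Type*} [NormedAddCommGroup E] [NormedSpace ℝ E]
  {H : Type*} [TopologicalSpace H] {I : ModelWithCorners ℝ E H}
  {M : Type*} [TopologicalSpace M] [ChartedSpace H M]

/-! Since `e3` is a multiple of a gradient, `D e3` is a symmetric endomorphism
(`IsLeviCivita.val_deriv_gradient_symm`); since `e3` is null, its values are orthogonal to `e3`.
Together these give D₃e₃ = 0, hence ω̲ = ξ̲ = 0. The PT frame keeps `e3`, so symmetry also makes χ̲
symmetric, which kills the anti-trace, and gives g(D₄e₃, e_a) = g(D_a e₃, e₄), which is η̲ = -ζ.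

For the transport equation, the bracket of `e3` with a horizontal field annihilates both u and s, so
it is orthogonal to the geodesic `e4`. This yields η = ζ in the geodesic frame
(`val_deriv_e4_e3_eq`). Passing to the PT frame leaves ∇₃f unchanged (`nabla3_ptFrame`) and changes
2ζ by χ̲·f (`two_mul_zeta_ptFrame`). Splitting χ̲ into trace and shear gives the formula. -/

theorem mvfderiv_apply_eq_fderivWithin {h : M → ℝ} {p : M} (hh : MDifferentiableAt I 𝓘(ℝ, ℝ) h p)
    (v : TangentSpace I p) :
    mvfderiv I h p v =
      fderivWithin ℝ (h ∘ (extChartAt I p).symm) (range I) (extChartAt I p p) v := by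
  rw [hh.mvfderiv]
  rfl

/-- Chain rule: the pullback applies the inverse of the differential of the inverse chart, and the
two cancel. -/
theorem mvfderiv_apply_eq_fderivWithin_mpullbackWithin [IsManifold I 1 M] {u : M → ℝ} {p : M}
    {y : E} (hy : y ∈ (extChartAt I p).target)
    (hu : MDifferentiableAt I 𝓘(ℝ, ℝ) u ((extChartAt I p).symm y))
    (Y : (q : M) → TangentSpace I q) :
    mvfderiv I u ((extChartAt I p).symm y) (Y ((extChartAt I p).symm y)) =
      fderivWithin ℝ (u ∘ (extChartAt I p).symm) (range I) y
        (mpullbackWithin 𝓘(ℝ, E) I (extChartAt I p).symm Y (range I) y) := by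
  have hyr : y ∈ range I := extChartAt_target_subset_range p hy
  have hφ : MDifferentiableWithinAt 𝓘(ℝ, E) I (extChartAt I p).symm (range I) y :=
    mdifferentiableWithinAt_extChartAt_symm hy
  have hcomp : fderivWithin ℝ (u ∘ (extChartAt I p).symm) (range I) y =
      (mvfderiv I u ((extChartAt I p).symm y)).comp
        (mfderivWithin 𝓘(ℝ, E) I (extChartAt I p).symm (range I) y) := by
    rw [← mfderivWithin_eq_fderivWithin]
    exact mfderiv_comp_mfderivWithin y hu hφ (I.uniqueMDiffOn y hyr)
  obtain ⟨A, hA⟩ := isInvertible_mfderivWithin_extChartAt_symm (I := I) hy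
  rw [hcomp, mpullbackWithin_apply, ← hA, ContinuousLinearMap.inverse_equiv]
  exact congrArg _ (A.apply_symm_apply _).symm

theorem mvfderiv_comp_extChartAt_symm_eventuallyEq [IsManifold I 1 M] {u : M → ℝ}
    (hu : MDifferentiable I 𝓘(ℝ, ℝ) u) (Y : (q : M) → TangentSpace I q) (p : M) :
    (fun q => mvfderiv I u q (Y q)) ∘ (extChartAt I p).symm =ᶠ[𝓝[range I] (extChartAt I p p)]
      fun y => fderivWithin ℝ (u ∘ (extChartAt I p).symm) (range I) y
        (mpullbackWithin 𝓘(ℝ, E) I (extChartAt I p).symm Y (range I) y) := by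
  filter_upwards [extChartAt_target_mem_nhdsWithin p] with y hy
  exact mvfderiv_apply_eq_fderivWithin_mpullbackWithin hy (hu _) Y

theorem contDiffWithinAt_comp_extChartAt_symm {u : M → ℝ} {n : ℕ∞ω}
    (hu : ContMDiff I 𝓘(ℝ, ℝ) n u) (p : M) :
    ContDiffWithinAt ℝ n (u ∘ (extChartAt I p).symm) (range I) (extChartAt I p p) := by
  have := (contMDiffAt_iff.1 (hu p)).2
  exact this

variable [CompleteSpace E] [IsManifold I 2 M]

/-- The Lie bracket of vector fields is the commutator of the derivations they define. -/
theorem mvfderiv_mlieBracket {u : M → ℝ} (hu : ContMDiff I 𝓘(ℝ, ℝ) 2 u)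
    {X Y : (q : M) → TangentSpace I q} {p : M}
    (hX : MDifferentiableAt I I.tangent
      (fun q => (Bundle.TotalSpace.mk' E q (X q) : TangentBundle I M)) p)
    (hY : MDifferentiableAt I I.tangent
      (fun q => (Bundle.TotalSpace.mk' E q (Y q) : TangentBundle I M)) p)
    (hX' : MDifferentiableAt I 𝓘(ℝ, ℝ) (fun q => mvfderiv I u q (X q)) p)
    (hY' : MDifferentiableAt I 𝓘(ℝ, ℝ) (fun q => mvfderiv I u q (Y q)) p) :
    mvfderiv I u p (mlieBracket I X Y p) =
      mvfderiv I (fun q => mvfderiv I u q (Y q)) p (X p) -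
        mvfderiv I (fun q => mvfderiv I u q (X q)) p (Y p) := by
  have : IsManifold I 1 M := .of_le (n := 2) (by norm_num)
  have hu1 : MDifferentiable I 𝓘(ℝ, ℝ) u := hu.mdifferentiable (by norm_num)
  have hp : extChartAt I p p ∈ range I := mem_range_self _
  -- Boundary points are allowed: the range of the model lies in the closure of its interior, so
  -- second derivatives are still symmetric there.
  have key := fderivWithin_apply_lieBracket (contDiffWithinAt_comp_extChartAt_symm hu p)
    (by simp) I.uniqueDiffOn (I.range_subset_closure_interior hp) hp
    (V := mpullbackWithin 𝓘(ℝ, E) I (extChartAt I p).symm X (range I))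
    (W := mpullbackWithin 𝓘(ℝ, E) I (extChartAt I p).symm Y (range I))
    (by simpa using
      (mdifferentiableWithinAt_univ.2 hY).differentiableWithinAt_mpullbackWithin_vectorField)
    (by simpa using
      (mdifferentiableWithinAt_univ.2 hX).differentiableWithinAt_mpullbackWithin_vectorField)
  -- At the base point of the preferred chart, the differential of the inverse chart is the
  -- identity.
  have hself : ∀ Z : (q : M) → TangentSpace I q,
      mpullbackWithin 𝓘(ℝ, E) I (extChartAt I p).symm Z (range I) (extChartAt I p p) = Z p := by
    intro Z
    exact (mfderivWithin_extChartAt_symm_inverse_apply (I := I) (x := p)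
      (v := (Z ((extChartAt I p).symm (extChartAt I p p)) : E))).trans
        (congrArg (fun q => (Z q : E)) (extChartAt_to_inv p))
  have hbr : mlieBracket I X Y p = lieBracketWithin ℝ
    (mpullbackWithin 𝓘(ℝ, E) I (extChartAt I p).symm X (range I))
    (mpullbackWithin 𝓘(ℝ, E) I (extChartAt I p).symm Y (range I)) (range I) (extChartAt I p p) := by
    rw [← mlieBracketWithin_univ, mlieBracketWithin_apply, mfderiv_extChartAt_self,
      preimage_univ, univ_inter]
    exact congrArg (fun A : E →L[ℝ] E => A _) (ContinuousLinearMap.inverse_id (R := ℝ) (M := E))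
  rw [mvfderiv_apply_eq_fderivWithin (hu1 p), hbr, key, hself, hself,
    mvfderiv_apply_eq_fderivWithin hX', mvfderiv_apply_eq_fderivWithin hY']
  rw [(mvfderiv_comp_extChartAt_symm_eventuallyEq hu1 X p).fderivWithin_eq_of_mem hp,
    (mvfderiv_comp_extChartAt_symm_eventuallyEq hu1 Y p).fderivWithin_eq_of_mem hp]

end

/-! ### Metric compatibility and covariant derivatives of gradients -/

namespace NullGeometry

section

open Set Filter VectorField
open scoped Topology

variable {E : Type*} [NormedAddCommGroup E] [NormedSpace ℝ E]
  {H : Type*} [TopologicalSpace H] {I : ModelWithCorners ℝ E H}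
  {M : Type*} [TopologicalSpace M] [ChartedSpace H M]

theorem mvfderiv_eq_zero_of_eventually_eq_const {h : M → ℝ} {p : M} {c : ℝ}
    (hc : ∀ᶠ q in 𝓝 p, h q = c) : mvfderiv I h p = 0 := by
  have h1 : mfderiv I 𝓘(ℝ, ℝ) h p = mfderiv I 𝓘(ℝ, ℝ) (fun _ => c) p :=
    Filter.EventuallyEq.mfderiv_eq hc
  rw [mvfderiv, h1, mfderiv_const]
  exact ContinuousLinearMap.comp_zero _

variable [IsManifold I ∞ M]

/-- The vector field `X` is differentiable at `p`. -/
def VField.DifferentiableAt (X : VField I M) (p : M) : Prop :=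
  MDifferentiableAt I I.tangent
    (fun q => (Bundle.TotalSpace.mk' E q (X q) : TangentBundle I M)) p

theorem VField.SmoothOn.differentiableAt {X : VField I M} {U : Set M} (hX : X.SmoothOn U)
    {p : M} (hU : U ∈ 𝓝 p) : X.DifferentiableAt p :=
  (ContMDiffOn.contMDiffAt hX hU).mdifferentiableAt (by simp)

/-- Torsion and metric compatibility are conditions on fields; extending vectors makes them usable
for pointwise identities. -/
theorem exists_differentiableAt_eq (p : M) (v : TangentSpace I p) :
    ∃ X : VField I M, X.DifferentiableAt p ∧ X p = v := by
  have : IsManifold I 1 M := .of_le (n := ∞) (by simp)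
  exact ⟨FiberBundle.extend E v, FiberBundle.mdifferentiableAt_extend .., by simp⟩

theorem LorentzMetric.mdifferentiableAt_val (g : LorentzMetric I M) {X Y : VField I M} {p : M}
    (hX : X.DifferentiableAt p) (hY : Y.DifferentiableAt p) :
    MDifferentiableAt I 𝓘(ℝ, ℝ) (fun q => g.val q (X q) (Y q)) p := by
  have h : MDifferentiableAt I (I.prod 𝓘(ℝ)) (fun q => Bundle.TotalSpace.mk' ℝ
      (E := Bundle.Trivial M ℝ) q (g.val q (X q) (Y q))) p :=
    MDifferentiableAt.clm_bundle_apply₂ (F₁ := E) (F₂ := E)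
      (g.smooth.mdifferentiableAt (by simp)) hX hY
  simp only [mdifferentiableAt_totalSpace] at h
  exact h.2

theorem OneForm.Smooth.mdifferentiableAt_apply {ψ : OneForm I M} (hψ : ψ.Smooth) {X : VField I M}
    {p : M} (hX : X.DifferentiableAt p) : MDifferentiableAt I 𝓘(ℝ, ℝ) (fun q => ψ q (X q)) p := by
  have h : MDifferentiableAt I (I.prod 𝓘(ℝ)) (fun q => Bundle.TotalSpace.mk' ℝ
      (E := Bundle.Trivial M ℝ) q (ψ q (X q))) p :=
    MDifferentiableAt.clm_bundle_apply (F₁ := E) (ContMDiff.mdifferentiableAt hψ (by simp)) hX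
  simp only [mdifferentiableAt_totalSpace] at h
  exact h.2

variable {g : LorentzMetric I M} {D : CovariantDerivative I E (TangentSpace I : M → Type _)}

theorem IsLeviCivita.val_deriv_eq_neg (hD : IsLeviCivita g D) {X Y : VField I M} {p : M} {c : ℝ}
    (hX : X.DifferentiableAt p) (hY : Y.DifferentiableAt p)
    (hc : ∀ᶠ q in 𝓝 p, g.val q (X q) (Y q) = c) (v : TangentSpace I p) :
    g.val p (D X p v) (Y p) = - g.val p (X p) (D Y p v) := by
  have := hD.metric X Y p v hX hY
  rw [mvfderiv_eq_zero_of_eventually_eq_const hc, zero_apply] at this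
  linarith

variable [CompleteSpace E]

/-- The covariant derivative of a multiple of a gradient is a symmetric endomorphism. -/
theorem IsLeviCivita.val_deriv_gradient_symm (hD : IsLeviCivita g D) {u : M → ℝ}
    (hu : ContMDiff I 𝓘(ℝ, ℝ) 2 u) {Z : VField I M} {c : ℝ} (hc : c ≠ 0)
    (hZ : ∀ (q : M) (v : TangentSpace I q), g.val q (Z q) v = c * mvfderiv I u q v) {p : M}
    (hZp : Z.DifferentiableAt p) (v w : TangentSpace I p) :
    g.val p (D Z p v) w = g.val p (D Z p w) v := by
  have : IsManifold I 2 M := .of_le (n := ∞) (by norm_cast)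
  obtain ⟨X, hX, rfl⟩ := exists_differentiableAt_eq p v
  obtain ⟨Y, hY, rfl⟩ := exists_differentiableAt_eq p w
  have hdu : ∀ (q : M) (v : TangentSpace I q), mvfderiv I u q v = c⁻¹ * g.val q (Z q) v := by
    intro q v
    rw [hZ]
    field_simp
  have hdiff : ∀ W : VField I M, W.DifferentiableAt p →
      MDifferentiableAt I 𝓘(ℝ, ℝ) (fun q => mvfderiv I u q (W q)) p := by
    intro W hW
    simp only [hdu]
    exact mdifferentiableAt_const.mul (g.mdifferentiableAt_val hZp hW)
  have hder : ∀ W : VField I M, W.DifferentiableAt p → ∀ v,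
      mvfderiv I (fun q => mvfderiv I u q (W q)) p v =
        c⁻¹ * (g.val p (D Z p v) (W p) + g.val p (Z p) (D W p v)) := by
    intro W hW v
    simp only [hdu]
    rw [← hD.metric Z W p v hZp hW,
      mvfderiv_fun_mul mdifferentiableAt_const (g.mdifferentiableAt_val hZp hW)]
    simp [mvfderiv_const]
  -- Expand [X,Y]u = X(Yu) - Y(Xu): by torsion-freeness the terms g(Z, D_X Y - D_Y X) cancel,
  -- leaving the symmetry.
  have key := mvfderiv_mlieBracket hu hX hY (hdiff X hX) (hdiff Y hY)
  rw [hdu, ← hD.torsion_free X Y p hX hY, hder Y hY, hder X hX, map_sub] at key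
  have hc' := inv_ne_zero hc
  have := mul_left_cancel₀ hc' (key.trans (mul_sub _ _ _).symm)
  linarith

end

end NullGeometry

/-! ### Pointwise algebra of the metric and of χ̲ -/

namespace NullGeometry

section

open Set Filter VectorField
open scoped Topology

variable {E : Type*} [NormedAddCommGroup E] [NormedSpace ℝ E]
  {H : Type*} [TopologicalSpace H] {I : ModelWithCorners ℝ E H}
  {M : Type*} [TopologicalSpace M] [ChartedSpace H M]

theorem Frame.eps_antisymm (vol : (p : M) → (TangentSpace I p) [⋀^Fin 4]→ₗ[ℝ] ℝ) (F : Frame I M)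
    (a b : Fin 2) (p : M) : F.eps vol a b p = - F.eps vol b a p := by
  have h := (vol p).map_swap ![F.e b p, F.e a p, F.e3 p, F.e4 p] (show (0 : Fin 4) ≠ 1 by decide)
  have hv : ![F.e b p, F.e a p, F.e3 p, F.e4 p] ∘ Equiv.swap (0 : Fin 4) 1 =
      ![F.e a p, F.e b p, F.e3 p, F.e4 p] := by
    funext i
    fin_cases i <;> rfl
  rw [hv] at h
  rw [eps, eps, h]
  ring

variable [IsManifold I ∞ M]
  {g : LorentzMetric I M} {D : CovariantDerivative I E (TangentSpace I : M → Type _)}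

/-- A nonzero such w would be orthogonal to the timelike t, hence satisfy g(w,w) > 0. -/
theorem LorentzMetric.eq_zero_of_forall_val_eq_zero (g : LorentzMetric I M) {p : M}
    {w : TangentSpace I p} (hw : ∀ v, g.val p w v = 0) : w = 0 := by
  by_contra hne
  obtain ⟨t, -, ht⟩ := g.signature p
  have := ht w (by rw [g.symm, hw]) hne
  rw [hw] at this
  exact lt_irrefl _ this

/-- An antisymmetric tensor contracted with a symmetric one vanishes. -/
theorem Frame.atrchib_eq_zero (vol : (p : M) → (TangentSpace I p) [⋀^Fin 4]→ₗ[ℝ] ℝ)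
    (F : Frame I M) {p : M} (hF : ∀ a b, F.chib g D a b p = F.chib g D b a p) :
    F.atrchib g D vol p = 0 := by
  have h00 := F.eps_antisymm vol 0 0 p
  have h11 := F.eps_antisymm vol 1 1 p
  have h0 : F.eps vol 0 0 p = 0 := by linarith
  have h1 : F.eps vol 1 1 p = 0 := by linarith
  simp only [atrchib, Fin.sum_univ_two, h0, h1, F.eps_antisymm vol 1 0 p, hF 1 0]
  ring

theorem Frame.sum_chibhat_mul (vol : (p : M) → (TangentSpace I p) [⋀^Fin 4]→ₗ[ℝ] ℝ)
    (F : Frame I M) {p : M} (hF : F.atrchib g D vol p = 0) (a : Fin 2) (x : Fin 2 → ℝ) :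
    ∑ b, F.chibhat g D vol a b p * x b =
      ∑ b, F.chib g D a b p * x b - (1 / 2 : ℝ) * F.trchib g D p * x a := by
  simp only [chibhat, hF, mul_zero, sub_zero, sub_mul, Finset.sum_sub_distrib]
  congr 1
  rw [Finset.sum_eq_single a (fun b _ hb => by simp [hb.symm]) (by simp)]
  simp

/-! ### The geodesic null pair -/

namespace GeodesicFoliation

variable {Hm1 : Set M} (G : GeodesicFoliation I M g Hm1)

theorem e3_differentiableAt (p : M) : G.e3.DifferentiableAt p :=
  G.e3_smooth.differentiableAt univ_mem

theorem e4_differentiableAt (p : M) : G.e4.DifferentiableAt p :=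
  G.e4_smooth.differentiableAt univ_mem

theorem mvfderiv_u_eq (p : M) (v : TangentSpace I p) :
    mvfderiv I G.u p v = (-1 / 2 : ℝ) * g.val p (G.e3 p) v := by
  rw [G.e3_eq]
  ring

/-- Vectors orthogonal to `e₃` and `e₄` are tangent to the surfaces `S_{u,s}`. -/
theorem mvfderiv_s_eq_zero {p : M} {v : TangentSpace I p} (h3 : g.val p v (G.e3 p) = 0)
    (h4 : g.val p v (G.e4 p) = 0) : mvfderiv I G.s p v = 0 := by
  -- Subtracting v(s) e₃ makes the vector tangent to S_{u,s}, because e₃(s) = 1 and e₃(u) = 0;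
  -- pairing with `e4` then leaves 2 v(s) = 0.
  have h := G.e4_orth p (v - mvfderiv I G.s p v • G.e3 p)
    (by rw [mvfderiv_u_eq, map_sub, map_smul, G.e3_null, g.symm, h3]; simp)
    (by rw [map_sub, map_smul, G.e3_s]; simp)
  rw [map_sub, map_smul, g.symm, h4, g.symm, G.e3_e4, smul_eq_mul] at h
  linarith

theorem val_deriv_e3_apply_e3 (hD : IsLeviCivita g D) (p : M) (v : TangentSpace I p) :
    g.val p (D G.e3 p v) (G.e3 p) = 0 := by
  have := hD.val_deriv_eq_neg (G.e3_differentiableAt p) (G.e3_differentiableAt p)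
    (.of_forall G.e3_null) v
  rw [g.symm p (G.e3 p)] at this
  linarith

section

variable [CompleteSpace E]

theorem val_deriv_e3_symm (hD : IsLeviCivita g D) (p : M) (v w : TangentSpace I p) :
    g.val p (D G.e3 p v) w = g.val p (D G.e3 p w) v :=
  hD.val_deriv_gradient_symm (G.u_smooth.of_le (by norm_cast)) (by norm_num) G.e3_eq
    (G.e3_differentiableAt p) v w

/-- The integral curves of `e₃` are affinely parametrized geodesics. -/
theorem deriv_e3_e3_eq_zero (hD : IsLeviCivita g D) (p : M) : D G.e3 p (G.e3 p) = 0 :=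
  g.eq_zero_of_forall_val_eq_zero fun v => by
    rw [G.val_deriv_e3_symm hD, G.val_deriv_e3_apply_e3 hD]

/-- The commutator of `e₃` with a horizontal vector field is orthogonal to `e₄`. -/
theorem val_e4_deriv_e3_eq (hD : IsLeviCivita g D) {X : VField I M} {p : M}
    (hX : X.DifferentiableAt p)
    (h3 : ∀ᶠ q in 𝓝 p, g.val q (X q) (G.e3 q) = 0)
    (h4 : ∀ᶠ q in 𝓝 p, g.val q (X q) (G.e4 q) = 0) :
    g.val p (G.e4 p) (D X p (G.e3 p)) = g.val p (G.e4 p) (D G.e3 p (X p)) := by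
  have : IsManifold I 2 M := .of_le (n := ∞) (by norm_cast)
  have he3 := G.e3_differentiableAt p
  have hu3 : ∀ᶠ q in 𝓝 p, mvfderiv I G.u q (G.e3 q) = 0 :=
    .of_forall fun q => by rw [G.mvfderiv_u_eq, G.e3_null, mul_zero]
  have huX : ∀ᶠ q in 𝓝 p, mvfderiv I G.u q (X q) = 0 :=
    h3.mono fun q hq => by rw [G.mvfderiv_u_eq, g.symm, hq, mul_zero]
  have hs3 : ∀ᶠ q in 𝓝 p, mvfderiv I G.s q (G.e3 q) = 1 := .of_forall G.e3_s
  have hsX : ∀ᶠ q in 𝓝 p, mvfderiv I G.s q (X q) = 0 := by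
    filter_upwards [h3, h4] with q hq3 hq4 using G.mvfderiv_s_eq_zero hq3 hq4
  -- The bracket kills every function whose derivatives along `e3` and X are locally constant; u and
  -- s are such functions.
  have hbr : ∀ {h : M → ℝ}, ContMDiff I 𝓘(ℝ, ℝ) ∞ h → ∀ {c d : ℝ},
      (∀ᶠ q in 𝓝 p, mvfderiv I h q (G.e3 q) = c) → (∀ᶠ q in 𝓝 p, mvfderiv I h q (X q) = d) →
      mvfderiv I h p (mlieBracket I G.e3 X p) = 0 := by
    intro h hh c d hc hd
    rw [mvfderiv_mlieBracket (hh.of_le (by norm_cast)) he3 hX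
      (mdifferentiableAt_const.congr_of_eventuallyEq hc)
      (mdifferentiableAt_const.congr_of_eventuallyEq hd),
      mvfderiv_eq_zero_of_eventually_eq_const hc, mvfderiv_eq_zero_of_eventually_eq_const hd]
    simp
  have h := G.e4_orth p _ (hbr G.u_smooth hu3 huX) (hbr G.s_smooth hs3 hsX)
  rw [← hD.torsion_free _ _ p he3 hX, map_sub] at h
  exact sub_eq_zero.1 h

/-- For the geodesic frame, `η = ζ`. -/
theorem val_deriv_e4_e3_eq (hD : IsLeviCivita g D) {X : VField I M} {p : M}
    (hX : X.DifferentiableAt p)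
    (h3 : ∀ᶠ q in 𝓝 p, g.val q (X q) (G.e3 q) = 0)
    (h4 : ∀ᶠ q in 𝓝 p, g.val q (X q) (G.e4 q) = 0) :
    g.val p (D G.e4 p (G.e3 p)) (X p) = - g.val p (D G.e3 p (X p)) (G.e4 p) := by
  rw [hD.val_deriv_eq_neg (G.e4_differentiableAt p) hX (h4.mono fun q hq => by rw [g.symm, hq]),
    G.val_e4_deriv_e3_eq hD hX h3 h4, g.symm]

end

/-! ### Change from the geodesic frame to the PT frame -/

variable {f : OneForm I M} {ε : Fin 2 → VField I M}

theorem apply_ptFrame_e (hf3 : ∀ p, f p (G.e3 p) = 0) (a : Fin 2) (p : M) :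
    f p ((G.ptFrame f ε).e a p) = f p (ε a p) := by
  simp [ptFrame, hf3]

variable {U : Set M}

theorem val_ptFrame_e4_e3 (hε : G.IsHorizontalFrameOn ε U) {p : M} (hp : p ∈ U) :
    g.val p ((G.ptFrame f ε).e4 p) (G.e3 p) = -2 := by
  simp [ptFrame, G.e3_null, g.symm p (G.e4 p), G.e3_e4, (hε.horizontal _ p hp).1]

theorem ptFrame_e_differentiableAt (hf : f.Smooth) {p : M}
    (hε : ∀ a, (ε a).DifferentiableAt p) (a : Fin 2) :
    ((G.ptFrame f ε).e a).DifferentiableAt p := by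
  have : IsManifold I 1 M := .of_le (n := ∞) (by simp)
  exact mdifferentiableAt_sub_section (hε a) (MDifferentiableAt.smul_section
    (mdifferentiableAt_const.mul (hf.mdifferentiableAt_apply (hε a))) (G.e3_differentiableAt p))

theorem ptFrame_e4_differentiableAt (hf : f.Smooth) {p : M}
    (hε : ∀ a, (ε a).DifferentiableAt p) :
    (G.ptFrame f ε).e4.DifferentiableAt p := by
  have : IsManifold I 1 M := .of_le (n := ∞) (by simp)
  have hfε := fun a => hf.mdifferentiableAt_apply (hε a)
  refine mdifferentiableAt_add_section (mdifferentiableAt_sub_section (G.e4_differentiableAt p)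
    (MDifferentiableAt.sum_section fun a _ => (hfε a).smul_section (hε a)))
    (MDifferentiableAt.smul_section (mdifferentiableAt_const.mul ?_) (G.e3_differentiableAt p))
  simp only [Fin.sum_univ_two]
  exact ((hfε 0).pow 2).add ((hfε 1).pow 2)

theorem val_ptFrame_e_e3 (hε : G.IsHorizontalFrameOn ε U) (a : Fin 2) {p : M} (hp : p ∈ U) :
    g.val p ((G.ptFrame f ε).e a p) (G.e3 p) = 0 := by
  simp [ptFrame, G.e3_null, (hε.horizontal a p hp).1]

theorem zeta_ptFrame (hD : IsLeviCivita g D) (hf : f.Smooth)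
    (hε : G.IsHorizontalFrameOn ε U) (hU : IsOpen U) {p : M} (hp : p ∈ U) (a : Fin 2) :
    (G.ptFrame f ε).zeta g D a p =
      -((1 / 2 : ℝ) * g.val p (D G.e3 p ((G.ptFrame f ε).e a p)) ((G.ptFrame f ε).e4 p)) := by
  have hUp := hU.mem_nhds hp
  rw [Frame.zeta, show (G.ptFrame f ε).e3 = G.e3 from rfl,
    hD.val_deriv_eq_neg (G.ptFrame_e4_differentiableAt hf fun a =>
      (hε.smooth a).differentiableAt hUp) (G.e3_differentiableAt p)
      (mem_of_superset hUp fun q hq => G.val_ptFrame_e4_e3 hε hq), g.symm]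
  ring

variable [CompleteSpace E]

theorem deriv_e3_ptFrame_e (hD : IsLeviCivita g D) (a : Fin 2) (p : M) :
    D G.e3 p ((G.ptFrame f ε).e a p) = D G.e3 p (ε a p) := by
  simp [ptFrame, G.deriv_e3_e3_eq_zero hD]

theorem chib_ptFrame_symm (hD : IsLeviCivita g D) (a b : Fin 2) (p : M) :
    (G.ptFrame f ε).chib g D a b p = (G.ptFrame f ε).chib g D b a p :=
  G.val_deriv_e3_symm hD p _ _

/-- The `e3` corrections drop out of both slots: D₃e₃ = 0 and `D e3` takes values orthogonal to
`e3`. -/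
theorem chib_ptFrame (hD : IsLeviCivita g D) (a b : Fin 2) (p : M) :
    (G.ptFrame f ε).chib g D a b p = g.val p (D G.e3 p (ε a p)) (ε b p) := by
  change g.val p (D G.e3 p ((G.ptFrame f ε).e a p)) ((G.ptFrame f ε).e b p) = _
  rw [G.deriv_e3_ptFrame_e hD]
  simp [ptFrame, G.val_deriv_e3_apply_e3 hD]

/-- The first term on the right is twice the geodesic ζ; the sum comes from the part -f^b ε_b of the
PT `e4`. -/
theorem two_mul_zeta_ptFrame (hD : IsLeviCivita g D) (hf : f.Smooth)
    (hε : G.IsHorizontalFrameOn ε U) (hU : IsOpen U) {p : M} (hp : p ∈ U) (a : Fin 2) :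
    2 * (G.ptFrame f ε).zeta g D a p = - g.val p (D G.e3 p (ε a p)) (G.e4 p)
      + ∑ b, (G.ptFrame f ε).chib g D a b p * f p (ε b p) := by
  rw [G.zeta_ptFrame hD hf hε hU hp, G.deriv_e3_ptFrame_e hD]
  simp only [G.chib_ptFrame hD]
  simp [ptFrame, G.val_deriv_e3_apply_e3 hD]
  ring

/-- As D₃e₃ = 0, the correction differentiates to a multiple of `e3`, which f annihilates. -/
theorem apply_deriv_ptFrame_e (hD : IsLeviCivita g D) (hf : f.Smooth)
    (hf3 : ∀ p, f p (G.e3 p) = 0) {p : M} (hε : ∀ a, (ε a).DifferentiableAt p) (a : Fin 2) :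
    f p (D ((G.ptFrame f ε).e a) p (G.e3 p)) = f p (D (ε a) p (G.e3 p)) := by
  have : IsManifold I 1 M := .of_le (n := ∞) (by simp)
  have hfε : MDifferentiableAt I 𝓘(ℝ, ℝ) (fun q => (-1 / 2 : ℝ) * f q (ε a q)) p :=
    mdifferentiableAt_const.mul (hf.mdifferentiableAt_apply (hε a))
  have hT : (G.ptFrame f ε).e a = ε a + (fun q => (-1 / 2 : ℝ) * f q (ε a q)) • G.e3 := by
    funext q
    change ε a q - ((1 / 2 : ℝ) * f q (ε a q)) • G.e3 q =
      ε a q + ((-1 / 2 : ℝ) * f q (ε a q)) • G.e3 q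
    module
  have he3 := G.e3_differentiableAt p
  rw [hT, D.isCovariantDerivativeOnUniv.add (hε a) (MDifferentiableAt.smul_section hfε he3),
    D.isCovariantDerivativeOnUniv.leibniz he3 hfε]
  simp [G.deriv_e3_e3_eq_zero hD, hf3]

theorem val_deriv_e3_of_orthogonal (hD : IsLeviCivita g D) {X : VField I M} {p : M}
    (hX : X.DifferentiableAt p) (h3 : ∀ᶠ q in 𝓝 p, g.val q (X q) (G.e3 q) = 0) :
    g.val p (D X p (G.e3 p)) (G.e3 p) = 0 := by
  rw [hD.val_deriv_eq_neg hX (G.e3_differentiableAt p) h3, G.deriv_e3_e3_eq_zero hD]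
  simp

/-- The derivative `∇₃ f` is the same for the PT frame and for the geodesic frame. -/
theorem nabla3_ptFrame (hD : IsLeviCivita g D) (hf : f.Smooth)
    (hf3 : ∀ p, f p (G.e3 p) = 0) (hf4 : ∀ p, f p (G.e4 p) = 0)
    (hε : G.IsHorizontalFrameOn ε U) (hU : IsOpen U) {p : M} (hp : p ∈ U) (a : Fin 2) :
    nabla3 g D (G.ptFrame f ε).e3 (G.ptFrame f ε).e4 f ((G.ptFrame f ε).e a) p =
      nabla3 g D G.e3 G.e4 f (ε a) p := by
  have hUp := hU.mem_nhds hp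
  have hεp := fun a => (hε.smooth a).differentiableAt hUp
  -- f equals -|f|² on the PT `e4`, so the coefficient of that vector in the projection has to
  -- vanish.
  have h1 : g.val p (D ((G.ptFrame f ε).e a) p (G.e3 p)) (G.e3 p) = 0 :=
    G.val_deriv_e3_of_orthogonal hD (G.ptFrame_e_differentiableAt hf hεp a)
      (mem_of_superset hUp fun q hq => G.val_ptFrame_e_e3 hε a hq)
  simp only [nabla3, horizontalProj, G.apply_ptFrame_e hf3, map_add, map_smul,
    show (G.ptFrame f ε).e3 = G.e3 from rfl, h1, hf3, hf4, G.apply_deriv_ptFrame_e hD hf hf3 hεp]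
  simp

end GeodesicFoliation

end

end NullGeometry

/-! ### The Ricci coefficients of the PT frame -/

theorem mainTheorem7 {E : Type*} [NormedAddCommGroup E] [NormedSpace ℝ E]
    (hdim : Module.finrank ℝ E = 4)
    {H : Type*} [TopologicalSpace H] (I : ModelWithCorners ℝ E H)
    (M : Type*) [TopologicalSpace M] [ChartedSpace H M] [IsManifold I ∞ M]
    (g : NullGeometry.LorentzMetric I M)
    (D : CovariantDerivative I E (TangentSpace I : M → Type _))
    (hD : NullGeometry.IsLeviCivita g D)
    (vol : (p : M) → (TangentSpace I p) [⋀^Fin 4]→ₗ[ℝ] ℝ)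
    (hvol : NullGeometry.IsVolumeForm g vol)
    (Hm1 : Set M) (G : NullGeometry.GeodesicFoliation I M g Hm1)
    (f : NullGeometry.OneForm I M) (hf : G.IsPTOneForm D f)
    (U : Set M) (hU : IsOpen U) (ε : Fin 2 → NullGeometry.VField I M)
    (hε : G.IsHorizontalFrameOn ε U)
    (T : NullGeometry.Frame I M) (hT : T = G.ptFrame f ε) :
    ∀ p ∈ U,
      T.omegab g D p = 0 ∧
      (∀ a, T.xib g D a p = 0) ∧
      (∀ a, T.etab g D a p = - T.zeta g D a p) ∧
      T.atrchib g D vol p = 0 ∧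
      (∀ a, NullGeometry.nabla3 g D T.e3 T.e4 f (T.e a) p =
        - (1 / 2 : ℝ) * T.trchib g D p * f p (T.e a p) + 2 * T.zeta g D a p
          - ∑ b, T.chibhat g D vol a b p * f p (T.e b p)) := by
  have : FiniteDimensional ℝ E := Module.finite_of_finrank_pos (by omega)
  have : CompleteSpace E := FiniteDimensional.complete ℝ E
  subst hT
  intro p hp
  have hUp := hU.mem_nhds hp
  have h33 := G.deriv_e3_e3_eq_zero hD p
  have hatr : (G.ptFrame f ε).atrchib g D vol p = 0 :=
    NullGeometry.Frame.atrchib_eq_zero vol _ fun a b => G.chib_ptFrame_symm hD a b p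
  refine ⟨?_, fun a => ?_, fun a => ?_, hatr, fun a => ?_⟩
  · change (1 / 4 : ℝ) * g.val p (D G.e3 p (G.e3 p)) _ = 0
    rw [h33]
    simp
  · change (1 / 2 : ℝ) * g.val p (D G.e3 p (G.e3 p)) _ = 0
    rw [h33]
    simp
  · rw [G.zeta_ptFrame hD hf.smooth hε hU hp, neg_neg, G.val_deriv_e3_symm hD]
    rfl
  -- The trace terms cancel, so the claim becomes 2η = 2ζ - χ̲·f, with η geodesic and ζ, χ̲ of the
  -- PT frame.
  · rw [NullGeometry.Frame.sum_chibhat_mul vol _ hatr a fun b => f p ((G.ptFrame f ε).e b p),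
      G.nabla3_ptFrame hD hf.smooth hf.apply_e3 hf.apply_e4 hε hU hp,
      hf.transport U (ε a) hU (hε.smooth a) (hε.horizontal a) p hp,
      NullGeometry.etaForm, G.val_deriv_e4_e3_eq hD ((hε.smooth a).differentiableAt hUp)
        (Filter.mem_of_superset hUp fun q hq => (hε.horizontal a q hq).1)
        (Filter.mem_of_superset hUp fun q hq => (hε.horizontal a q hq).2),
      G.two_mul_zeta_ptFrame hD hf.smooth hε hU hp]
    simp only [G.apply_ptFrame_e hf.apply_e3]
    ring
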